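/- Let $N_U$ users and $N_I$ items be given, with a real prediction matrix $P=(P_{ij})$ and a real affinity matrix $Y=(Y_{ij})$ ($1\le i\le N_U$, $1\le j\le N_I$). For a finite set $S$ of items and $x,y\in\mathbb{R}^{N_I}$ let $$\mathrm{corr}_S(x,y)=\frac{\sum_{j\in S}(x_j-\bar x_S)(y_j-\bar y_S)}{\sqrt{\sum_{j\in S}(x_j-\bar x_S)^2\,\sum_{j\in S}(y_j-\bar y_S)^2}},\qquad \bar x_S=\frac1{|S|}\sum_{j\in S}x_j ,$$ with the value $0$ where $x$ or $y$ is constant on $S$, and let $\mathrm{corr}$ be the correlation over all items. Put $$L^{c}=\frac1{N_U}\sum_{i=1}^{N_U}\bigl(1-\mathrm{corr}(P_i,Y_i)\bigr),\qquad L^{c_S}=\frac1{|S_U|}\sum_{i\in S_U}\bigl(1-\mathrm{corr}_{S_I}(P_i,Y_i)\bigr)$$ for sets $S_U$ of users and $S_I$ of items. For an item $j$ let $\nabla_j L=(\partial L/\partial P_{ij})_{i}$ be the vector, indexed by the users, of partial derivatives with respect to the predictions for item $j$; a partial derivative that does not exist (which happens only for samples $S_I$ on which $P_i$ is constant) is counted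 as $0$. Let $S_U$ be a uniformly random set of $N_{S_U}$ users and $S_I$ a uniformly random set of $N_{S_I}$ items, where $1\le N_{S_U}\le N_U$ and $1\le N_{S_I}\le N_I$. Then $$\mathbb{E}_{S_U}\mathbb{E}_{S_I}\bigl[\nabla_j L^{c_S}\bigr]=\nabla_j L^{c}+\mathcal{O}(1/N_{S_I}),$$ uniformly in the following sense. For all real $B$ and all $\sigma,\delta>0$ there is a constant $C$, depending on $B,\sigma,\delta$ only, such that for all $N_U,N_I$ and all $P,Y$ with * $|P_{ij}|\le B$ and $|Y_{ij}|\le B$ for all $i,j$, * variance of each row $P_i$ and of each row $Y_i$ over all items at least $\sigma^2$, * $|P_{ia}-P_{ib}|\ge\delta$ whenever $P_{ia}\ne P_{ib}$, the following hold: $L^{c}$ is differentiable in the prediction matrix at $P$; $L^{c_S}$ is differentiable at $P$ for all $S_U,S_I$ such that no $P_i$ with $i\in S_U$ is constant on $S_I$; and for all $N_{S_U}$, $N_{S_I}$ as above, all items $j$ and all users $i$, $$\left|\mathbb{E}_{S_U}\mathbb{E}_{S_I}\!\left[\frac{\partial L^{c_S}}{\partial P_{ij}}\right]-\frac{\partial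 L^{c}}{\partial P_{ij}}\right|\le\frac{C}{N_U\,N_I\,N_{S_I}} .$$ (Any given matrices without constant rows satisfy the three conditions for some $B,\sigma,\delta$.) -/

import Mathlib

noncomputable section

namespace SampleCorr

/-- The arithmetic mean of `x` over the finite set `S`. -/
def mean {ι : Type*} (S : Finset ι) (x : ι → ℝ) : ℝ :=
  (∑ j ∈ S, x j) / (S.card : ℝ)

/-- The Pearson correlation of `x` and `y` over the finite set `S`. Where it is undefined
(`x` or `y` is constant on `S`) it takes the value `0`. -/
def corr {ι : Type*} (S : Finset ι) (x y : ι → ℝ) : ℝ :=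
  (∑ j ∈ S, (x j - mean S x) * (y j - mean S y)) /
    Real.sqrt ((∑ j ∈ S, (x j - mean S x) ^ 2) * (∑ j ∈ S, (y j - mean S y) ^ 2))

/-- The population variance of `x` over all items. -/
def variance {N : ℕ} (x : Fin N → ℝ) : ℝ :=
  mean Finset.univ (fun j => (x j - mean Finset.univ x) ^ 2)

/-- The full per-user correlation loss of the prediction matrix `P` against the affinity
matrix `Y` (rows are users, columns are items). -/
def fullLoss {NU NI : ℕ} (P Y : Fin NU → Fin NI → ℝ) : ℝ :=
  (∑ i, (1 - corr Finset.univ (P i) (Y i))) / (NU : ℝ)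

/-- The correlation loss computed from the users in `SU` and the items in `SI` only. -/
def sampleLoss {NU NI : ℕ} (SU : Finset (Fin NU)) (SI : Finset (Fin NI))
    (P Y : Fin NU → Fin NI → ℝ) : ℝ :=
  (∑ i ∈ SU, (1 - corr SI (P i) (Y i))) / (SU.card : ℝ)

/-- The item-`j` part of the gradient of a loss `L` with respect to the prediction matrix:
the vector, indexed by the users `i`, of the partial derivatives of `L` with respect to the
entry `P i j`, at the matrix `P`. -/
def grad {NU NI : ℕ} (j : Fin NI) (L : (Fin NU → Fin NI → ℝ) → ℝ)
    (P : Fin NU → Fin NI → ℝ) : Fin NU → ℝ :=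
  fun i => deriv (fun t : ℝ => L (Function.update P i (Function.update (P i) j t))) (P i j)

/-- The expectation of `f S` when `S` is a uniformly random `n`-element subset of `Fin N`. -/
def expect {N : ℕ} (n : ℕ) (f : Finset (Fin N) → ℝ) : ℝ :=
  (∑ S ∈ Finset.powersetCard n Finset.univ, f S) / (N.choose n : ℝ)

end SampleCorr

end

namespace SampleCorr

/-! User sampling is exact: user `i` lies in the sample with probability m/N_U and then carries
weight 1/m. Likewise only item samples through `j` contribute, a share n/N_I of all of them. It
remains to average over `setsThrough j n` and to show that n times the partial derivative of the
correlation on `S` differs on average from its full-population value by O(1/n).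

Where both variances on `S` are positive, this scaled derivative is a fixed smooth function,
`scaledPartial`, of the means over `S` of seven features; the entries x_j, y_j enter as means of
constant functions. The argument is then a delta method. Forcing `j` into `S` biases the sample
means by only O(1/n), so the linear Taylor term averages to O(1/n); the remainder is controlled by
second moments, also O(1/n).

Taylor expansion fails when the sample moments are farther than ε from the full ones, since the
sample variance may then be tiny. There the separation δ gives |∂corr| ≤ 4/δ
(`abs_deriv_corr_update_le`), so the scaled derivative is O(n). Fourth moments are O(1/n²), so such
samples have probability O(1/n²) and also contribute O(1/n). -/

/-- The `n`-element sets of items containing `j`. -/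
def setsThrough {α : Type*} [Fintype α] [DecidableEq α] (j : α) (n : ℕ) : Finset (Finset α) :=
  (Finset.powersetCard n Finset.univ).filter (j ∈ ·)

/-! ### Moments of sums over random sets through a fixed element -/

section Sampling

variable {α : Type*} [Fintype α] [DecidableEq α]

theorem mem_setsThrough {j : α} {n : ℕ} {S : Finset α} :
    S ∈ setsThrough j n ↔ S.card = n ∧ j ∈ S := by
  simp [setsThrough, Finset.mem_powersetCard]

/-- Double counting: remove from a set of size n + 1 any of its n elements other than `j`, or add to
a set of size n any outside element. This drives every induction on the sample size below. -/
theorem sum_setsThrough_succ (j : α) (n : ℕ) (h : Finset α → ℝ) :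
    (n : ℝ) * ∑ S ∈ setsThrough j (n + 1), h S
      = ∑ S ∈ setsThrough j n, ∑ a ∈ Sᶜ, h (insert a S) := by
  have h1 : (n : ℝ) * ∑ S ∈ setsThrough j (n + 1), h S
      = ∑ S ∈ setsThrough j (n + 1), ∑ _a ∈ S.erase j, h S := by
    rw [Finset.mul_sum]
    refine Finset.sum_congr rfl fun S hS => ?_
    obtain ⟨hc, hj⟩ := mem_setsThrough.1 hS
    rw [Finset.sum_const, Finset.card_erase_of_mem hj, hc, nsmul_eq_mul, Nat.add_sub_cancel]
  rw [h1, Finset.sum_sigma', Finset.sum_sigma']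
  refine Finset.sum_nbij' (fun p => ⟨p.1.erase p.2, p.2⟩) (fun p => ⟨insert p.2 p.1, p.2⟩)
    ?_ ?_ ?_ ?_ ?_
  · rintro ⟨S, a⟩ hp
    simp only [Finset.mem_sigma, mem_setsThrough, Finset.mem_erase, Finset.mem_compl] at hp ⊢
    obtain ⟨⟨hc, hj⟩, haj, ha⟩ := hp
    refine ⟨⟨?_, Ne.symm haj, hj⟩, by simp⟩
    rw [Finset.card_erase_of_mem ha, hc, Nat.add_sub_cancel]
  · rintro ⟨S, a⟩ hp
    simp only [Finset.mem_sigma, mem_setsThrough, Finset.mem_erase, Finset.mem_compl] at hp ⊢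
    obtain ⟨⟨hc, hj⟩, ha⟩ := hp
    refine ⟨⟨by rw [Finset.card_insert_of_notMem ha, hc], Finset.mem_insert_of_mem hj⟩, ?_,
      Finset.mem_insert_self _ _⟩
    rintro rfl
    exact ha hj
  · rintro ⟨S, a⟩ hp
    simp only [Finset.mem_sigma, Finset.mem_erase] at hp
    simp [Finset.insert_erase hp.2.2]
  · rintro ⟨S, a⟩ hp
    simp only [Finset.mem_sigma, Finset.mem_compl] at hp
    simp [Finset.erase_insert hp.2]
  · rintro ⟨S, a⟩ hp
    simp only [Finset.mem_sigma, Finset.mem_erase] at hp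
    simp [Finset.insert_erase hp.2.2]

theorem card_compl_of_mem_setsThrough {j : α} {n : ℕ} {S : Finset α} (hS : S ∈ setsThrough j n) :
    ((Sᶜ.card : ℕ) : ℝ) = Fintype.card α - n := by
  have hc := (mem_setsThrough.1 hS).1
  rw [Finset.card_compl, Nat.cast_sub (Finset.card_le_univ S), hc]

theorem card_setsThrough_succ (j : α) (n : ℕ) :
    (n : ℝ) * (setsThrough j (n + 1)).card
      = ((Fintype.card α : ℝ) - n) * (setsThrough j n).card := by
  have := sum_setsThrough_succ j n (fun _ => (1 : ℝ))
  simp only [Finset.sum_const, nsmul_eq_mul, mul_one] at this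
  rw [this, Finset.sum_congr rfl fun S hS => card_compl_of_mem_setsThrough hS, Finset.sum_const,
    nsmul_eq_mul, mul_comm]

theorem setsThrough_one (j : α) : setsThrough j 1 = {{j}} := by
  ext S
  rw [mem_setsThrough, Finset.card_eq_one, Finset.mem_singleton]
  constructor
  · rintro ⟨⟨a, rfl⟩, h⟩
    rw [Finset.mem_singleton.1 h]
  · rintro rfl
    exact ⟨⟨j, rfl⟩, by simp⟩

/-- A uniform `n`-set contains `j` with probability n/N. The double-counting recursion for these
cardinalities is that of the binomial coefficients C(N - 1, n - 1). -/
theorem card_mul_card_setsThrough (j : α) {n : ℕ} (hn : 1 ≤ n) :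
    (Fintype.card α : ℝ) * (setsThrough j n).card = n * (Fintype.card α).choose n := by
  obtain ⟨k, hk⟩ : ∃ k, Fintype.card α = k + 1 :=
    ⟨Fintype.card α - 1, (Nat.sub_add_cancel (Fintype.card_pos_iff.2 ⟨j⟩)).symm⟩
  have key : ∀ m : ℕ, (setsThrough j (m + 1)).card = k.choose m := by
    intro m
    induction m with
    | zero => simp [setsThrough_one]
    | succ m ih =>
      have h1 := card_setsThrough_succ j (m + 1)
      rw [ih, hk] at h1
      have h2 : (k.choose (m + 1) : ℝ) * (m + 1) = k.choose m * (k - m) := by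
        rcases le_or_gt m k with h | h
        · have := Nat.choose_succ_right_eq k m
          rw [← Nat.cast_sub h]
          exact_mod_cast this
        · rw [Nat.choose_eq_zero_of_lt h, Nat.choose_eq_zero_of_lt (Nat.lt_succ_of_lt h)]
          simp
      have h3 : ((m : ℝ) + 1) ≠ 0 := by positivity
      push_cast at h1
      have : ((setsThrough j (m + 1 + 1)).card : ℝ) = k.choose (m + 1) := by
        apply mul_left_cancel₀ h3
        linarith
      exact_mod_cast this
  obtain ⟨m, rfl⟩ : ∃ m, n = m + 1 := ⟨n - 1, (Nat.sub_add_cancel hn).symm⟩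
  rw [key, hk]
  have := Nat.add_one_mul_choose_eq k m
  have h : ((k + 1 : ℕ) : ℝ) * (k.choose m : ℝ) = ((k + 1).choose (m + 1) : ℝ) * ((m + 1 : ℕ) : ℝ) := by
    exact_mod_cast this
  rw [h, mul_comm]

theorem sum_compl_of_sum_eq_zero {a : α → ℝ} (h0 : ∑ k, a k = 0) (S : Finset α) :
    ∑ k ∈ Sᶜ, a k = -∑ k ∈ S, a k := by
  have := Finset.sum_add_sum_compl S a
  linarith

theorem setsThrough_induction_bound {j : α} {n : ℕ} (hn : 1 ≤ n) (h : Finset α → ℝ)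
    {b : ℝ} (hb : ∑ S ∈ setsThrough j n, ∑ a ∈ Sᶜ, h (insert a S)
      ≤ ((Fintype.card α : ℝ) - n) * (b * (setsThrough j n).card)) :
    ∑ S ∈ setsThrough j (n + 1), h S ≤ b * (setsThrough j (n + 1)).card := by
  have hn' : (0 : ℝ) < n := by exact_mod_cast hn
  rw [← sum_setsThrough_succ] at hb
  refine le_of_mul_le_mul_left (hb.trans (le_of_eq ?_)) hn'
  have := card_setsThrough_succ j n
  calc _ = b * (((Fintype.card α : ℝ) - n) * (setsThrough j n).card) := by ring
    _ = _ := by rw [← this]; ring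

variable {a : α → ℝ} {M : ℝ}

/-- Given `S`, the elements still available sum to minus the current sum, so drawing one more
shrinks the mean sum by a factor. The bias never exceeds that of the forced element `j`. -/
theorem abs_sum_setsThrough_le (h0 : ∑ k, a k = 0) (hM : ∀ k, |a k| ≤ M) (j : α) {n : ℕ}
    (hn : 1 ≤ n) (hnN : n ≤ Fintype.card α) :
    |∑ S ∈ setsThrough j n, ∑ k ∈ S, a k| ≤ M * (setsThrough j n).card := by
  have hM0 : 0 ≤ M := (abs_nonneg _).trans (hM j)
  induction n, hn using Nat.le_induction with
  | base => simpa [setsThrough_one] using hM j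
  | succ n hn ih =>
    have hn' : (0 : ℝ) < n := by exact_mod_cast hn
    have hN : (n : ℝ) + 1 ≤ Fintype.card α := by exact_mod_cast hnN
    have ih := ih (by omega)
    have h1 := sum_setsThrough_succ j n (fun S => ∑ k ∈ S, a k)
    have h2 : ∑ S ∈ setsThrough j n, ∑ b ∈ Sᶜ, ∑ k ∈ insert b S, a k
        = ((Fintype.card α : ℝ) - n - 1) * ∑ S ∈ setsThrough j n, ∑ k ∈ S, a k := by
      rw [Finset.mul_sum]
      refine Finset.sum_congr rfl fun S hS => ?_
      rw [Finset.sum_congr rfl fun b hb => Finset.sum_insert (Finset.mem_compl.1 hb),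
        Finset.sum_add_distrib, sum_compl_of_sum_eq_zero h0, Finset.sum_const, nsmul_eq_mul,
        card_compl_of_mem_setsThrough hS]
      ring
    rw [h2] at h1
    refine le_of_mul_le_mul_left ?_ hn'
    calc (n : ℝ) * |∑ S ∈ setsThrough j (n + 1), ∑ k ∈ S, a k|
        = |(n : ℝ) * ∑ S ∈ setsThrough j (n + 1), ∑ k ∈ S, a k| := by
          rw [abs_mul, abs_of_pos hn']
      _ = ((Fintype.card α : ℝ) - n - 1) * |∑ S ∈ setsThrough j n, ∑ k ∈ S, a k| := by
          rw [h1, abs_mul, abs_of_nonneg (by linarith)]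
      _ ≤ ((Fintype.card α : ℝ) - n) * (M * (setsThrough j n).card) := by
          exact mul_le_mul (by linarith) ih (abs_nonneg _) (by linarith)
      _ = M * (((Fintype.card α : ℝ) - n) * (setsThrough j n).card) := by ring
      _ = _ := by rw [← card_setsThrough_succ]; ring

/-- Since `a` has total 0, the cross term 2T·a_b summed over the complement is -2T² ≤ 0: sampling
without replacement only helps, and each draw adds at most M². -/
theorem sum_sq_setsThrough_le (h0 : ∑ k, a k = 0) (hM : ∀ k, |a k| ≤ M) (j : α) {n : ℕ}
    (hn : 1 ≤ n) (hnN : n ≤ Fintype.card α) :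
    ∑ S ∈ setsThrough j n, (∑ k ∈ S, a k) ^ 2 ≤ (n * M ^ 2) * (setsThrough j n).card := by
  have hsq : ∀ k, a k ^ 2 ≤ M ^ 2 := fun k => sq_le_sq' (abs_le.1 (hM k)).1 (abs_le.1 (hM k)).2
  induction n, hn using Nat.le_induction with
  | base => simpa [setsThrough_one] using hsq j
  | succ n hn ih =>
    have hN : (n : ℝ) + 1 ≤ Fintype.card α := by exact_mod_cast hnN
    have ih := ih (by omega)
    refine setsThrough_induction_bound hn _ ?_
    calc ∑ S ∈ setsThrough j n, ∑ b ∈ Sᶜ, (∑ k ∈ insert b S, a k) ^ 2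
        ≤ ∑ S ∈ setsThrough j n,
            ((Fintype.card α : ℝ) - n) * ((∑ k ∈ S, a k) ^ 2 + M ^ 2) := by
          refine Finset.sum_le_sum fun S hS => ?_
          have hc := card_compl_of_mem_setsThrough hS
          set T := ∑ k ∈ S, a k with hT
          calc ∑ b ∈ Sᶜ, (∑ k ∈ insert b S, a k) ^ 2
              ≤ ∑ b ∈ Sᶜ, ((T ^ 2 + M ^ 2) + 2 * T * a b) := by
                refine Finset.sum_le_sum fun b hb => ?_
                rw [Finset.sum_insert (Finset.mem_compl.1 hb), ← hT]
                linarith [hsq b]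
            _ = ((Fintype.card α : ℝ) - n) * (T ^ 2 + M ^ 2) - 2 * T ^ 2 := by
                rw [Finset.sum_add_distrib, ← Finset.mul_sum, sum_compl_of_sum_eq_zero h0,
                  Finset.sum_const, nsmul_eq_mul, hc]
                ring
            _ ≤ _ := by linarith [sq_nonneg T]
      _ = ((Fintype.card α : ℝ) - n) *
            (∑ S ∈ setsThrough j n, (∑ k ∈ S, a k) ^ 2 + M ^ 2 * (setsThrough j n).card) := by
          rw [← Finset.mul_sum, Finset.sum_add_distrib, Finset.sum_const, nsmul_eq_mul]
          ring
      _ ≤ _ := by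
          refine mul_le_mul_of_nonneg_left ?_ (by linarith)
          push_cast
          linarith

theorem sum_pow_four_setsThrough_le (h0 : ∑ k, a k = 0) (hM : ∀ k, |a k| ≤ M) (j : α) {n : ℕ}
    (hn : 1 ≤ n) (hnN : n ≤ Fintype.card α) :
    ∑ S ∈ setsThrough j n, (∑ k ∈ S, a k) ^ 4
      ≤ (4 * n ^ 2 * M ^ 4) * (setsThrough j n).card := by
  have hsq : ∀ k, a k ^ 2 ≤ M ^ 2 := fun k => sq_le_sq' (abs_le.1 (hM k)).1 (abs_le.1 (hM k)).2
  have hfo : ∀ k, a k ^ 4 ≤ M ^ 4 := fun k => by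
    have := pow_le_pow_left₀ (sq_nonneg (a k)) (hsq k) 2
    rwa [← pow_mul, ← pow_mul] at this
  induction n, hn using Nat.le_induction with
  | base =>
    simp only [setsThrough_one, Finset.sum_singleton, Finset.card_singleton]
    have := hfo j
    have h2 : 0 ≤ M ^ 4 := by positivity
    push_cast
    linarith
  | succ n hn ih =>
    have hN : (n : ℝ) + 1 ≤ Fintype.card α := by exact_mod_cast hnN
    have ih := ih (by omega)
    have ih2 := sum_sq_setsThrough_le h0 hM j hn (by omega)
    refine setsThrough_induction_bound hn _ ?_
    calc ∑ S ∈ setsThrough j n, ∑ b ∈ Sᶜ, (∑ k ∈ insert b S, a k) ^ 4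
        ≤ ∑ S ∈ setsThrough j n, ((Fintype.card α : ℝ) - n) *
            ((∑ k ∈ S, a k) ^ 4 + 8 * M ^ 2 * (∑ k ∈ S, a k) ^ 2 + 3 * M ^ 4) := by
          refine Finset.sum_le_sum fun S hS => ?_
          have hc := card_compl_of_mem_setsThrough hS
          set T := ∑ k ∈ S, a k with hT
          calc ∑ b ∈ Sᶜ, (∑ k ∈ insert b S, a k) ^ 4
              -- The odd term 4Ta³ is absorbed by 2T²a² + 2a⁴, from a²(T - a)² ≥ 0. The induction
              -- then closes because 4n² + 8n + 3 ≤ 4(n + 1)².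
              ≤ ∑ b ∈ Sᶜ, ((T ^ 4 + 8 * M ^ 2 * T ^ 2 + 3 * M ^ 4) + 4 * T ^ 3 * a b) := by
                refine Finset.sum_le_sum fun b hb => ?_
                rw [Finset.sum_insert (Finset.mem_compl.1 hb), ← hT]
                have e1 : T ^ 2 * a b ^ 2 ≤ T ^ 2 * M ^ 2 :=
                  mul_le_mul_of_nonneg_left (hsq b) (sq_nonneg T)
                have e2 : 0 ≤ a b ^ 2 * (T - a b) ^ 2 := by positivity
                linarith [hfo b]
            _ = ((Fintype.card α : ℝ) - n) * (T ^ 4 + 8 * M ^ 2 * T ^ 2 + 3 * M ^ 4)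
                  - 4 * T ^ 4 := by
                rw [Finset.sum_add_distrib, ← Finset.mul_sum, sum_compl_of_sum_eq_zero h0,
                  Finset.sum_const, nsmul_eq_mul, hc]
                ring
            _ ≤ _ := by
                have : 0 ≤ T ^ 4 := by positivity
                linarith
      _ = ((Fintype.card α : ℝ) - n) *
            (∑ S ∈ setsThrough j n, (∑ k ∈ S, a k) ^ 4
              + 8 * M ^ 2 * ∑ S ∈ setsThrough j n, (∑ k ∈ S, a k) ^ 2
              + 3 * M ^ 4 * (setsThrough j n).card) := by
          rw [← Finset.mul_sum, Finset.sum_add_distrib, Finset.sum_add_distrib, Finset.sum_const,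
            nsmul_eq_mul, ← Finset.mul_sum]
          ring
      _ ≤ _ := by
          refine mul_le_mul_of_nonneg_left ?_ (by linarith)
          have h3 : 8 * M ^ 2 * ∑ S ∈ setsThrough j n, (∑ k ∈ S, a k) ^ 2
              ≤ 8 * M ^ 2 * ((n * M ^ 2) * (setsThrough j n).card) :=
            mul_le_mul_of_nonneg_left ih2 (by positivity)
          have h4 : 0 ≤ M ^ 4 * ((setsThrough j n).card : ℝ) := by positivity
          push_cast
          linarith

end Sampling

/-! ### Second-order Taylor bound, uniform over a compact set -/

/-- A closed thickening of `K` is compact and still inside `Ω`, so `G` and its first two derivatives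
are bounded on it; the mean value inequality, used on `fderiv ℝ G` and then on `G`, gives the
remainder. -/
theorem exists_uniform_taylor_bound {E : Type*} [NormedAddCommGroup E] [NormedSpace ℝ E]
    [FiniteDimensional ℝ E] {G : E → ℝ} {Ω K : Set E} (hΩ : IsOpen Ω) (hK : IsCompact K)
    (hKΩ : K ⊆ Ω) (hG : ContDiffOn ℝ 2 G Ω) :
    ∃ ε > 0, ∃ C ≥ 0, ∀ m₀ ∈ K, |G m₀| ≤ C ∧ ‖fderiv ℝ G m₀‖ ≤ C ∧
      ∀ m, ‖m - m₀‖ ≤ ε → m ∈ Ω ∧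
        |G m - G m₀ - fderiv ℝ G m₀ (m - m₀)| ≤ C * ‖m - m₀‖ ^ 2 := by
  have : ProperSpace E := FiniteDimensional.proper ℝ E
  obtain ⟨ε, hε, hsub⟩ := hK.exists_cthickening_subset_open hΩ hKΩ
  have hK' : IsCompact (Metric.cthickening ε K) := hK.cthickening
  have hD : ContDiffOn ℝ 1 (fderiv ℝ G) Ω := hG.fderiv_of_isOpen hΩ (by norm_num)
  have hDD : ContinuousOn (fderiv ℝ (fderiv ℝ G)) Ω :=
    hD.continuousOn_fderiv_of_isOpen hΩ le_rfl
  obtain ⟨C₁, hC₁⟩ := hK'.exists_bound_of_continuousOn (hG.continuousOn.mono hsub)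
  obtain ⟨C₂, hC₂⟩ := hK'.exists_bound_of_continuousOn (hD.continuousOn.mono hsub)
  obtain ⟨C₃, hC₃⟩ := hK'.exists_bound_of_continuousOn (E := E →L[ℝ] E →L[ℝ] ℝ)
    (f := fderiv ℝ (fderiv ℝ G)) (hDD.mono hsub)
  refine ⟨ε, hε, max 0 (max C₁ (max C₂ C₃)), le_max_left _ _, fun m₀ hm₀ => ?_⟩
  set C := max 0 (max C₁ (max C₂ C₃))
  have hC0 : 0 ≤ C := le_max_left _ _
  have h1 : C₁ ≤ C := (le_max_left _ _).trans (le_max_right _ _)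
  have h2 : C₂ ≤ C := (le_max_left _ _).trans ((le_max_right _ _).trans (le_max_right _ _))
  have h3 : C₃ ≤ C := (le_max_right _ _).trans ((le_max_right _ _).trans (le_max_right _ _))
  have hmem : m₀ ∈ Metric.cthickening ε K := Metric.self_subset_cthickening K hm₀
  have hball : Metric.closedBall m₀ ε ⊆ Metric.cthickening ε K :=
    Metric.closedBall_subset_cthickening hm₀ ε
  refine ⟨(hC₁ m₀ hmem).trans h1, (hC₂ m₀ hmem).trans h2, fun m hm => ?_⟩
  have hmb : m ∈ Metric.closedBall m₀ ε := by rwa [mem_closedBall_iff_norm]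
  refine ⟨hsub (hball hmb), ?_⟩
  have hr : ∀ x ∈ Metric.closedBall m₀ ‖m - m₀‖, x ∈ Metric.closedBall m₀ ε := fun x hx =>
    Metric.closedBall_subset_closedBall hm hx
  have hdG : ∀ x ∈ Ω, DifferentiableAt ℝ G x := fun x hx =>
    (hG.differentiableOn (by norm_num)).differentiableAt (hΩ.mem_nhds hx)
  have hdD : ∀ x ∈ Ω, DifferentiableAt ℝ (fderiv ℝ G) x := fun x hx =>
    (hD.differentiableOn (by norm_num)).differentiableAt (hΩ.mem_nhds hx)
  have hlip : ∀ x ∈ Metric.closedBall m₀ ‖m - m₀‖,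
      ‖fderiv ℝ G x - fderiv ℝ G m₀‖ ≤ C * ‖m - m₀‖ := by
    intro x hx
    have := (convex_closedBall m₀ ε).norm_image_sub_le_of_norm_fderiv_le (𝕜 := ℝ) (C := C)
      (fun y hy => hdD y (hsub (hball hy))) (fun y hy => (hC₃ y (hball hy)).trans h3)
      (Metric.mem_closedBall_self hε.le) (hr x hx)
    refine this.trans (mul_le_mul_of_nonneg_left ?_ hC0)
    rwa [mem_closedBall_iff_norm] at hx
  have := (convex_closedBall m₀ ‖m - m₀‖).norm_image_sub_le_of_norm_fderiv_le' (𝕜 := ℝ)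
    (fun y hy => hdG y (hsub (hball (hr y hy)))) hlip
    (Metric.mem_closedBall_self (norm_nonneg _)) (y := m) (by rw [mem_closedBall_iff_norm])
  rw [Real.norm_eq_abs] at this
  refine this.trans (le_of_eq (by ring))

/-! ### The delta method for sample means -/

section DeltaMethod

variable {α : Type*} [Fintype α] [DecidableEq α]

theorem abs_mean_le {α : Type*} (S : Finset α) {f : α → ℝ} {M : ℝ} (hM0 : 0 ≤ M)
    (hM : ∀ k, |f k| ≤ M) : |mean S f| ≤ M := by
  unfold mean
  rcases S.eq_empty_or_nonempty with rfl | hS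
  · simpa using hM0
  have hc : (0 : ℝ) < S.card := by exact_mod_cast hS.card_pos
  rw [abs_div, abs_of_pos hc, div_le_iff₀ hc]
  calc |∑ k ∈ S, f k| ≤ ∑ k ∈ S, |f k| := Finset.abs_sum_le_sum_abs _ _
    _ ≤ ∑ _k ∈ S, M := Finset.sum_le_sum fun k _ => hM k
    _ = M * S.card := by rw [Finset.sum_const, nsmul_eq_mul, mul_comm]

theorem sum_sub_mean_eq {α : Type*} (S : Finset α) (f : α → ℝ) (c : ℝ) (hS : S.Nonempty) :
    (∑ k ∈ S, (f k - c)) / S.card = mean S f - c := by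
  have hc : (S.card : ℝ) ≠ 0 := by exact_mod_cast hS.card_pos.ne'
  unfold mean
  rw [Finset.sum_sub_distrib, Finset.sum_const, nsmul_eq_mul]
  field_simp

theorem norm_pow_le_sum_pow {p : ℕ} (v : Fin p → ℝ) {r : ℕ} (hr : Even r) (hr0 : r ≠ 0) :
    ‖v‖ ^ r ≤ ∑ i, v i ^ r := by
  rcases Nat.eq_zero_or_pos p with rfl | hp
  · rw [Subsingleton.elim v 0, norm_zero, zero_pow hr0]
    simp
  obtain ⟨i, -, hi⟩ := Finset.exists_mem_eq_sup Finset.univ ⟨⟨0, hp⟩, Finset.mem_univ _⟩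
    (fun i => ‖v i‖₊)
  rw [Pi.norm_def, hi, coe_nnnorm, Real.norm_eq_abs, hr.pow_abs]
  exact Finset.single_le_sum (f := fun i => v i ^ r) (fun i _ => hr.pow_nonneg _)
    (Finset.mem_univ i)

/-- The error allows for a quartic term weighted by n because `g` may be of size n away from the
full means; fourth moments of order 1/n² pay for it. -/
theorem abs_sum_setsThrough_delta_le {p : ℕ} {F : Fin p → α → ℝ} {M A : ℝ} (hM0 : 0 ≤ M)
    (hM : ∀ i k, |F i k| ≤ M) (j : α) {n : ℕ} (hn : 1 ≤ n) (hnN : n ≤ Fintype.card α)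
    (g : Finset α → ℝ) (g₀ : ℝ) (L : (Fin p → ℝ) →L[ℝ] ℝ) (hA : 0 ≤ A) (hL : ‖L‖ ≤ A)
    (hg : ∀ S ∈ setsThrough j n,
      |g S - g₀ - L (fun i => mean S (F i) - mean Finset.univ (F i))|
        ≤ A * (‖fun i => mean S (F i) - mean Finset.univ (F i)‖ ^ 2
          + n * ‖fun i => mean S (F i) - mean Finset.univ (F i)‖ ^ 4)) :
    |∑ S ∈ setsThrough j n, (g S - g₀)|
      ≤ A * (2 * M + p * (4 * M ^ 2 + 64 * M ^ 4)) / n * (setsThrough j n).card := by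
  have hn' : (0 : ℝ) < n := by exact_mod_cast hn
  set d : Finset α → Fin p → ℝ := fun S i => mean S (F i) - mean Finset.univ (F i) with hd
  set a : Fin p → α → ℝ := fun i k => F i k - mean Finset.univ (F i) with ha
  have hNe : (Finset.univ : Finset α).Nonempty := ⟨j, Finset.mem_univ j⟩
  have ha0 : ∀ i, ∑ k, a i k = 0 := by
    intro i
    have := sum_sub_mean_eq Finset.univ (F i) (mean Finset.univ (F i)) hNe
    rw [sub_self, div_eq_zero_iff] at this
    exact this.resolve_right (by exact_mod_cast hNe.card_pos.ne')
  -- Centring doubles the bound, whence 4M² = (2M)² and 64M⁴ = 4(2M)⁴ in the final constant.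
  have haM : ∀ i k, |a i k| ≤ 2 * M := by
    intro i k
    calc |a i k| ≤ |F i k| + |mean Finset.univ (F i)| := abs_sub _ _
      _ ≤ M + M := add_le_add (hM i k) (abs_mean_le _ hM0 (hM i))
      _ = 2 * M := by ring
  have hda : ∀ S ∈ setsThrough j n, ∀ i, d S i = (∑ k ∈ S, a i k) / n := by
    intro S hS i
    obtain ⟨hc, hj⟩ := mem_setsThrough.1 hS
    rw [← hc, sum_sub_mean_eq S (F i) _ ⟨j, hj⟩]
  set c : ℝ := ((setsThrough j n).card : ℝ) with hc
  have hc0 : 0 ≤ c := Nat.cast_nonneg _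
  have h1 : ‖∑ S ∈ setsThrough j n, d S‖ ≤ 2 * M / n * c := by
    refine (pi_norm_le_iff_of_nonneg (by positivity)).2 fun i => ?_
    rw [Finset.sum_apply, Finset.sum_congr rfl fun S hS => hda S hS i, ← Finset.sum_div,
      Real.norm_eq_abs, abs_div, abs_of_pos hn', div_mul_eq_mul_div]
    exact div_le_div_of_nonneg_right (abs_sum_setsThrough_le (ha0 i) (haM i) j hn hnN) hn'.le
  have h2 : ∑ S ∈ setsThrough j n, ‖d S‖ ^ 2 ≤ p * (4 * M ^ 2 / n * c) := by
    calc ∑ S ∈ setsThrough j n, ‖d S‖ ^ 2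
        ≤ ∑ S ∈ setsThrough j n, ∑ i, d S i ^ 2 :=
          Finset.sum_le_sum fun S _ => norm_pow_le_sum_pow _ (by decide) (by decide)
      _ = ∑ i, ∑ S ∈ setsThrough j n, d S i ^ 2 := Finset.sum_comm
      _ ≤ ∑ _i : Fin p, (4 * M ^ 2 / n * c) := by
          refine Finset.sum_le_sum fun i _ => ?_
          rw [Finset.sum_congr rfl fun S hS => by rw [hda S hS i, div_pow], ← Finset.sum_div,
            div_le_iff₀ (by positivity)]
          refine (sum_sq_setsThrough_le (ha0 i) (haM i) j hn hnN).trans (le_of_eq ?_)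
          field_simp
          ring
      _ = _ := by simp
  have h4 : ∑ S ∈ setsThrough j n, n * ‖d S‖ ^ 4 ≤ p * (64 * M ^ 4 / n * c) := by
    calc ∑ S ∈ setsThrough j n, n * ‖d S‖ ^ 4
        ≤ ∑ S ∈ setsThrough j n, n * ∑ i, d S i ^ 4 :=
          Finset.sum_le_sum fun S _ => mul_le_mul_of_nonneg_left
            (norm_pow_le_sum_pow _ (by decide) (by decide)) hn'.le
      _ = ∑ i, n * ∑ S ∈ setsThrough j n, d S i ^ 4 := by
          rw [← Finset.mul_sum, Finset.sum_comm, Finset.mul_sum]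
      _ ≤ ∑ _i : Fin p, (64 * M ^ 4 / n * c) := by
          refine Finset.sum_le_sum fun i _ => ?_
          rw [Finset.sum_congr rfl fun S hS => by rw [hda S hS i, div_pow], ← Finset.sum_div,
            mul_div_assoc', div_le_iff₀ (by positivity)]
          refine (mul_le_mul_of_nonneg_left
            (sum_pow_four_setsThrough_le (ha0 i) (haM i) j hn hnN) hn'.le).trans (le_of_eq ?_)
          field_simp
          ring
      _ = _ := by simp
  -- The linear term is summed before norms are taken, to use the cancellation in `h1`; bounding it
  -- set by set would give only order n^(-1/2).
  have h5 : ∑ S ∈ setsThrough j n, (g S - g₀)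
      = ∑ S ∈ setsThrough j n, (g S - g₀ - L (d S)) + L (∑ S ∈ setsThrough j n, d S) := by
    rw [map_sum, ← Finset.sum_add_distrib]
    exact Finset.sum_congr rfl fun S _ => by ring
  rw [h5]
  calc _ ≤ |∑ S ∈ setsThrough j n, (g S - g₀ - L (d S))| + |L (∑ S ∈ setsThrough j n, d S)| :=
        abs_add_le _ _
    _ ≤ A * (p * (4 * M ^ 2 / n * c) + p * (64 * M ^ 4 / n * c)) + A * (2 * M / n * c) := by
        refine add_le_add ?_ ?_
        · calc _ ≤ ∑ S ∈ setsThrough j n, |g S - g₀ - L (d S)| := Finset.abs_sum_le_sum_abs _ _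
            _ ≤ ∑ S ∈ setsThrough j n, A * (‖d S‖ ^ 2 + n * ‖d S‖ ^ 4) :=
                Finset.sum_le_sum hg
            _ = A * (∑ S ∈ setsThrough j n, ‖d S‖ ^ 2
                  + ∑ S ∈ setsThrough j n, n * ‖d S‖ ^ 4) := by
                rw [← Finset.mul_sum, Finset.sum_add_distrib]
            _ ≤ _ := mul_le_mul_of_nonneg_left (add_le_add h2 h4) hA
        · exact (L.le_opNorm _).trans (mul_le_mul hL h1 (norm_nonneg _) hA)
    _ = _ := by
        field_simp
        ring

end DeltaMethod

/-! ### Correlation in terms of moments -/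

section Moments

variable {ι : Type*}

theorem sum_sub_mean_mul_sub_mean (S : Finset ι) (x y : ι → ℝ) :
    ∑ j ∈ S, (x j - mean S x) * (y j - mean S y)
      = S.card * (mean S (fun j => x j * y j) - mean S x * mean S y) := by
  rcases S.eq_empty_or_nonempty with rfl | hS
  · simp
  have hc : (S.card : ℝ) ≠ 0 := by exact_mod_cast hS.card_pos.ne'
  have h1 : ∑ j ∈ S, (x j - mean S x) * (y j - mean S y)
      = ∑ j ∈ S, x j * y j - mean S x * ∑ j ∈ S, y j - mean S y * ∑ j ∈ S, x j
        + S.card * (mean S x * mean S y) := by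
    rw [Finset.mul_sum, Finset.mul_sum, ← nsmul_eq_mul, ← Finset.sum_const,
      ← Finset.sum_sub_distrib, ← Finset.sum_sub_distrib, ← Finset.sum_add_distrib]
    exact Finset.sum_congr rfl fun j _ => by ring
  rw [h1]
  unfold mean
  field_simp
  ring

theorem sum_sub_mean_sq (S : Finset ι) (x : ι → ℝ) :
    ∑ j ∈ S, (x j - mean S x) ^ 2
      = S.card * (mean S (fun j => x j ^ 2) - mean S x ^ 2) := by
  simpa only [sq] using sum_sub_mean_mul_sub_mean S x x

theorem mean_sq_sub_sq_mean_nonneg {S : Finset ι} (hS : S.Nonempty) (x : ι → ℝ) :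
    0 ≤ mean S (fun j => x j ^ 2) - mean S x ^ 2 := by
  have hc : (0 : ℝ) < S.card := by exact_mod_cast hS.card_pos
  have h : 0 ≤ ∑ j ∈ S, (x j - mean S x) ^ 2 := Finset.sum_nonneg fun j _ => sq_nonneg _
  rw [sum_sub_mean_sq] at h
  exact nonneg_of_mul_nonneg_right h hc

theorem corr_eq_moments {S : Finset ι} (hS : S.Nonempty) (x y : ι → ℝ) :
    corr S x y = (mean S (fun j => x j * y j) - mean S x * mean S y) /
      Real.sqrt ((mean S (fun j => x j ^ 2) - mean S x ^ 2) *
        (mean S (fun j => y j ^ 2) - mean S y ^ 2)) := by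
  have hc : (0 : ℝ) < S.card := by exact_mod_cast hS.card_pos
  unfold corr
  rw [sum_sub_mean_mul_sub_mean, sum_sub_mean_sq, sum_sub_mean_sq, mul_mul_mul_comm,
    Real.sqrt_mul (by positivity), Real.sqrt_mul_self hc.le, mul_div_mul_left _ _ hc.ne']

theorem mean_const {S : Finset ι} (hS : S.Nonempty) (c : ℝ) :
    mean S (fun _ => c) = c := by
  have hc : (S.card : ℝ) ≠ 0 := by exact_mod_cast hS.card_pos.ne'
  unfold mean
  rw [Finset.sum_const, nsmul_eq_mul]
  field_simp

theorem mean_congr {S : Finset ι} {f g : ι → ℝ} (h : ∀ k ∈ S, f k = g k) :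
    mean S f = mean S g := by
  unfold mean
  rw [Finset.sum_congr rfl h]

theorem corr_eq_zero_of_right {S : Finset ι} {y : ι → ℝ} (hS : S.Nonempty)
    (hy : mean S (fun k => y k ^ 2) - mean S y ^ 2 = 0) (x : ι → ℝ) : corr S x y = 0 := by
  rw [corr_eq_moments hS, hy, mul_zero, Real.sqrt_zero, div_zero]

theorem sq_sub_mean_le {S : Finset ι} {j : ι} (hj : j ∈ S) (x : ι → ℝ) :
    (x j - mean S x) ^ 2 ≤ S.card * (mean S (fun k => x k ^ 2) - mean S x ^ 2) := by
  rw [← sum_sub_mean_sq]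
  exact Finset.single_le_sum (f := fun k => (x k - mean S x) ^ 2) (fun k _ => sq_nonneg _) hj

theorem sq_cov_le {S : Finset ι} (hS : S.Nonempty) (x y : ι → ℝ) :
    (mean S (fun k => x k * y k) - mean S x * mean S y) ^ 2
      ≤ (mean S (fun k => x k ^ 2) - mean S x ^ 2) *
        (mean S (fun k => y k ^ 2) - mean S y ^ 2) := by
  have hc : (0 : ℝ) < S.card := by exact_mod_cast hS.card_pos
  have := Finset.sum_mul_sq_le_sq_mul_sq S (fun k => x k - mean S x) (fun k => y k - mean S y)
  rw [sum_sub_mean_mul_sub_mean, sum_sub_mean_sq, sum_sub_mean_sq] at this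
  have hc2 : (0 : ℝ) < (S.card : ℝ) ^ 2 := by positivity
  refine le_of_mul_le_mul_left ?_ hc2
  calc _ = _ := (mul_pow _ _ 2).symm
    _ ≤ _ := this
    _ = _ := by ring

variable [DecidableEq ι]

theorem mean_update {S : Finset ι} {j : ι} (hj : j ∈ S) (x : ι → ℝ) (φ : ι → ℝ → ℝ) (t : ℝ) :
    mean S (fun k => φ k (Function.update x j t k))
      = mean S (fun k => φ k (x k)) + (φ j t - φ j (x j)) / S.card := by
  unfold mean
  rw [← add_div, ← Finset.add_sum_erase S _ hj, ← Finset.add_sum_erase S (fun k => φ k (x k)) hj,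
    Function.update_self, Finset.sum_congr rfl fun k hk => by
      rw [Function.update_of_ne (Finset.ne_of_mem_erase hk)]]
  ring

theorem corr_update_of_notMem {S : Finset ι} {j : ι} (hj : j ∉ S) (x y : ι → ℝ) (t : ℝ) :
    corr S (Function.update x j t) y = corr S x y := by
  have h : ∀ k ∈ S, Function.update x j t k = x k := fun k hk =>
    Function.update_of_ne (ne_of_mem_of_not_mem hk hj) _ _
  have hm := mean_congr h
  unfold corr
  rw [hm]
  congr 1
  · exact Finset.sum_congr rfl fun k hk => by rw [h k hk]
  · congr 2
    exact Finset.sum_congr rfl fun k hk => by rw [h k hk]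

theorem corr_update_of_mem {S : Finset ι} {j : ι} (hj : j ∈ S) (x y : ι → ℝ) (t : ℝ) :
    corr S (Function.update x j t) y =
      (mean S (fun k => x k * y k) + (t * y j - x j * y j) / S.card
        - (mean S x + (t - x j) / S.card) * mean S y) /
      Real.sqrt ((mean S (fun k => x k ^ 2) + (t ^ 2 - x j ^ 2) / S.card
          - (mean S x + (t - x j) / S.card) ^ 2) *
        (mean S (fun k => y k ^ 2) - mean S y ^ 2)) := by
  rw [corr_eq_moments ⟨j, hj⟩, mean_update hj x (fun k s => s * y k) t,
    mean_update hj x (fun _ s => s ^ 2) t, mean_update hj x (fun _ s => s) t]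

end Moments

/-! ### The partial derivative as a function of moments -/

/-- The partial derivative of the correlation with respect to an entry, up to the number of items,
as a function of the moments: the means of `x`, `y`, `x²`, `y²`, `xy` and the entries
`x j`, `y j`. -/
noncomputable def scaledPartial (m : Fin 7 → ℝ) : ℝ :=
  (m 6 - m 1) / Real.sqrt ((m 2 - m 0 ^ 2) * (m 3 - m 1 ^ 2))
    - (m 4 - m 0 * m 1) * (m 5 - m 0) /
      ((m 2 - m 0 ^ 2) * Real.sqrt ((m 2 - m 0 ^ 2) * (m 3 - m 1 ^ 2)))

/-- The functions of the item whose means over `S` are the arguments of `scaledPartial`. -/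
noncomputable def features {ι : Type*} (x y : ι → ℝ) (j : ι) : Fin 7 → ι → ℝ :=
  ![x, y, fun k => x k ^ 2, fun k => y k ^ 2, fun k => x k * y k, fun _ => x j, fun _ => y j]

/-- One squared deviation is at most the sum of all, and the covariance obeys Cauchy–Schwarz. Each
of the two terms then has square at most 1/(|S|·Var x) ≤ 2/δ², whatever the variance of `y`. -/
theorem abs_scaledPartial_div_le {ι : Type*} {S : Finset ι} {j : ι} (hj : j ∈ S) {x y : ι → ℝ} {δ : ℝ} (hδ : 0 < δ)
    (hx : δ ^ 2 / 2 ≤ S.card * (mean S (fun k => x k ^ 2) - mean S x ^ 2))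
    (hy : 0 < mean S (fun k => y k ^ 2) - mean S y ^ 2) :
    |scaledPartial (fun i => mean S (features x y j i)) / S.card| ≤ 4 / δ := by
  have hS : S.Nonempty := ⟨j, hj⟩
  have hc : (0 : ℝ) < S.card := by exact_mod_cast hS.card_pos
  have e1 := sq_sub_mean_le hj x
  have e2 := sq_sub_mean_le hj y
  have e3 := sq_cov_le hS x y
  simp only [scaledPartial, features, Matrix.cons_val, mean_const hS]
  set V := mean S (fun k => x k ^ 2) - mean S x ^ 2
  set W := mean S (fun k => y k ^ 2) - mean S y ^ 2
  set C := mean S (fun k => x k * y k) - mean S x * mean S y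
  set u := x j - mean S x
  set v := y j - mean S y
  set N : ℝ := (S.card : ℝ)
  have hV : 0 < V := pos_of_mul_pos_right (lt_of_lt_of_le (by positivity) hx) hc.le
  have hs : 0 < Real.sqrt (V * W) := Real.sqrt_pos.2 (mul_pos hV hy)
  have hss : Real.sqrt (V * W) ^ 2 = V * W := Real.sq_sqrt (mul_pos hV hy).le
  set s := Real.sqrt (V * W)
  have b1 : |v / s / N| ≤ 2 / δ := by
    refine abs_le_of_sq_le_sq ?_ (by positivity)
    rw [div_pow, div_pow, hss, div_div, div_pow, div_le_div_iff₀ (by positivity) (by positivity)]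
    calc v ^ 2 * δ ^ 2 ≤ (N * W) * (2 * (N * V)) :=
          mul_le_mul e2 (by linarith) (by positivity) (by positivity)
      _ ≤ 2 ^ 2 * (V * W * N ^ 2) := by
          have : 0 ≤ V * W * N ^ 2 := by positivity
          linarith
  have b2 : |C * u / (V * s) / N| ≤ 2 / δ := by
    refine abs_le_of_sq_le_sq ?_ (by positivity)
    rw [div_pow, div_pow, div_pow, mul_pow, mul_pow, hss, div_div,
      div_le_div_iff₀ (by positivity) (by positivity)]
    calc C ^ 2 * u ^ 2 * δ ^ 2 ≤ (V * W) * (N * V) * (2 * (N * V)) :=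
          mul_le_mul (mul_le_mul e3 e1 (by positivity) (by positivity)) (by linarith)
            (by positivity) (by positivity)
      _ ≤ 2 ^ 2 * (V ^ 2 * (V * W) * N ^ 2) := by
          have : 0 ≤ V ^ 2 * (V * W) * N ^ 2 := by positivity
          linarith
  rw [sub_div]
  calc _ ≤ |v / s / N| + |C * u / (V * s) / N| := abs_sub _ _
    _ ≤ 2 / δ + 2 / δ := add_le_add b1 b2
    _ = 4 / δ := by ring

/-! ### Derivative of the correlation in one entry, and its crude bound -/

section Derivative

variable {ι : Type*} [DecidableEq ι] {S : Finset ι} {j : ι}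

theorem hasDerivAt_corr_update (hj : j ∈ S) {x y : ι → ℝ}
    (hx : 0 < mean S (fun k => x k ^ 2) - mean S x ^ 2)
    (hy : 0 < mean S (fun k => y k ^ 2) - mean S y ^ 2) :
    HasDerivAt (fun t => corr S (Function.update x j t) y)
      (scaledPartial (fun i => mean S (features x y j i)) / S.card) (x j) := by
  have hS : S.Nonempty := ⟨j, hj⟩
  have hc : (S.card : ℝ) ≠ 0 := by exact_mod_cast hS.card_pos.ne'
  simp only [corr_update_of_mem hj]
  have hid := hasDerivAt_id' (x j)
  have hC : HasDerivAt (fun t : ℝ => mean S (fun k => x k * y k) + (t * y j - x j * y j) / S.card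
      - (mean S x + (t - x j) / S.card) * mean S y)
      ((1 * y j) / S.card - (1 / S.card) * mean S y) (x j) :=
    ((((hid.mul_const (y j)).sub_const _).div_const _).const_add _).sub
      ((((hid.sub_const _).div_const _).const_add _).mul_const _)
  have hV : HasDerivAt (fun t : ℝ => (mean S (fun k => x k ^ 2) + (t ^ 2 - x j ^ 2) / S.card
          - (mean S x + (t - x j) / S.card) ^ 2) *
        (mean S (fun k => y k ^ 2) - mean S y ^ 2))
      ((((2 : ℕ) * x j ^ (2 - 1) * 1) / S.card
        - (2 : ℕ) * (mean S x + (x j - x j) / S.card) ^ (2 - 1) * (1 / S.card)) *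
        (mean S (fun k => y k ^ 2) - mean S y ^ 2)) (x j) :=
    (((((hid.pow 2).sub_const _).div_const _).const_add _).sub
      ((((hid.sub_const _).div_const _).const_add _).pow 2)).mul_const _
  have hpos := mul_pos hx hy
  have hne : (mean S (fun k => x k ^ 2) + (x j ^ 2 - x j ^ 2) / S.card
          - (mean S x + (x j - x j) / S.card) ^ 2) *
        (mean S (fun k => y k ^ 2) - mean S y ^ 2) ≠ 0 := by
    simpa using hpos.ne'
  have hD := hC.div (hV.sqrt hne) (Real.sqrt_ne_zero'.2 (by simpa using hpos))
  refine hD.congr_deriv ?_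
  have hs : 0 < Real.sqrt ((mean S (fun k => x k ^ 2) - mean S x ^ 2) *
        (mean S (fun k => y k ^ 2) - mean S y ^ 2)) := Real.sqrt_pos.2 hpos
  have hss := Real.sq_sqrt hpos.le
  simp only [scaledPartial, features, sub_self, zero_div, add_zero, Matrix.cons_val,
    mean_const hS]
  set s := Real.sqrt ((mean S (fun k => x k ^ 2) - mean S x ^ 2) *
        (mean S (fun k => y k ^ 2) - mean S y ^ 2))
  rw [hss]
  set V := mean S (fun k => x k ^ 2) - mean S x ^ 2
  set W := mean S (fun k => y k ^ 2) - mean S y ^ 2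
  have hV0 := hx.ne'
  have hW0 := hy.ne'
  have hs0 := hs.ne'
  have h3 : s ^ 3 = s * (V * W) := by rw [← hss]; ring
  push_cast
  field_simp
  rw [hss]
  ring

/-- The function is κ times the sign of t - c, with value 0 at c as 0/0 = 0. Either κ = 0 or it
jumps, and then `deriv` takes its default value 0. -/
theorem deriv_sign_mul (c κ : ℝ) : deriv (fun t : ℝ => (t - c) / |t - c| * κ) c = 0 := by
  by_cases h : DifferentiableAt ℝ (fun t : ℝ => (t - c) / |t - c| * κ) c
  · have h1 : Filter.Tendsto (fun t : ℝ => (t - c) / |t - c| * κ) (nhdsWithin c (Set.Ioi c))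
        (nhds 0) := by
      have := h.continuousAt.tendsto.mono_left (nhdsWithin_le_nhds (s := Set.Ioi c))
      simpa using this
    have h2 : Filter.Tendsto (fun t : ℝ => (t - c) / |t - c| * κ) (nhdsWithin c (Set.Ioi c))
        (nhds κ) := by
      refine tendsto_const_nhds.congr' ?_
      filter_upwards [self_mem_nhdsWithin] with t ht
      have : 0 < t - c := sub_pos.2 ht
      rw [abs_of_pos this, div_self this.ne', one_mul]
    have hκ := tendsto_nhds_unique h1 h2
    simp [← hκ]
  · exact deriv_zero_of_not_differentiableAt h

theorem deriv_corr_update_of_const (hj : j ∈ S) {x y : ι → ℝ} (hx : ∀ k ∈ S, x k = x j) :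
    deriv (fun t => corr S (Function.update x j t) y) (x j) = 0 := by
  have hS : S.Nonempty := ⟨j, hj⟩
  have hc : (0 : ℝ) < S.card := by exact_mod_cast hS.card_pos
  have h1 : mean S x = x j := (mean_congr hx).trans (mean_const hS _)
  have h2 : mean S (fun k => x k ^ 2) = x j ^ 2 :=
    (mean_congr fun k hk => by rw [hx k hk]).trans (mean_const hS _)
  have h3 : mean S (fun k => x k * y k) = x j * mean S y := by
    rw [mean_congr (g := fun k => x j * y k) fun k hk => by rw [hx k hk]]
    unfold mean
    rw [← Finset.mul_sum, mul_div_assoc]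
  -- Moving one entry of a constant row makes the covariance linear in t - x_j and the variance a
  -- multiple of (t - x_j)², so only the sign of t - x_j survives.
  have h4 : (fun t => corr S (Function.update x j t) y) = fun t : ℝ => (t - x j) / |t - x j| *
      ((y j - mean S y) / S.card / Real.sqrt ((1 / S.card - 1 / (S.card : ℝ) ^ 2) *
        (mean S (fun k => y k ^ 2) - mean S y ^ 2))) := by
    funext t
    rw [corr_update_of_mem hj, h1, h2, h3, div_mul_div_comm, ← Real.sqrt_sq_eq_abs,
      ← Real.sqrt_mul (sq_nonneg _)]
    congr 1
    · field_simp
      ring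
    · congr 1
      field_simp
      ring
  rw [h4, deriv_sign_mul]

theorem sq_le_card_mul_variance {x : ι → ℝ} {δ : ℝ} (hδ : 0 < δ) {a b : ι} (ha : a ∈ S)
    (hb : b ∈ S) (hab : δ ≤ |x a - x b|) :
    δ ^ 2 / 2 ≤ S.card * (mean S (fun k => x k ^ 2) - mean S x ^ 2) := by
  have hne : a ≠ b := by
    rintro rfl
    rw [sub_self, abs_zero] at hab
    linarith
  have h1 : ∑ k ∈ ({a, b} : Finset ι), (x k - mean S x) ^ 2 ≤ ∑ k ∈ S, (x k - mean S x) ^ 2 := by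
    refine Finset.sum_le_sum_of_subset_of_nonneg ?_ fun k _ _ => sq_nonneg _
    intro k hk
    rcases Finset.mem_insert.1 hk with rfl | hk
    · exact ha
    · rwa [Finset.mem_singleton.1 hk]
  rw [Finset.sum_pair hne, sum_sub_mean_sq] at h1
  have h2 : δ ^ 2 ≤ (x a - x b) ^ 2 := by
    rw [← sq_abs (x a - x b)]
    exact pow_le_pow_left₀ hδ.le hab 2
  -- For the deviations u, v of `x a` and `x b` from the mean, u² + v² ≥ (u - v)²/2.
  have h3 := sq_nonneg ((x a - mean S x) + (x b - mean S x))
  linarith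

theorem abs_deriv_corr_update_le (hj : j ∈ S) {x y : ι → ℝ} {δ : ℝ} (hδ : 0 < δ)
    (hsep : ∀ a b, x a ≠ x b → δ ≤ |x a - x b|) :
    |deriv (fun t => corr S (Function.update x j t) y) (x j)| ≤ 4 / δ := by
  have hS : S.Nonempty := ⟨j, hj⟩
  have hc : (0 : ℝ) < S.card := by exact_mod_cast hS.card_pos
  have h0 : 0 ≤ 4 / δ := by positivity
  by_cases hx : ∀ k ∈ S, x k = x j
  · rwa [deriv_corr_update_of_const hj hx, abs_zero]
  push Not at hx
  obtain ⟨k, hk, hkj⟩ := hx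
  have hV := sq_le_card_mul_variance hδ hk hj (hsep k j hkj)
  rcases (mean_sq_sub_sq_mean_nonneg hS y).eq_or_lt with hy | hy
  · simpa only [corr_eq_zero_of_right hS hy.symm, deriv_const, abs_zero] using h0
  · rw [(hasDerivAt_corr_update hj
      (pos_of_mul_pos_right (lt_of_lt_of_le (by positivity) hV) hc.le) hy).deriv]
    exact abs_scaledPartial_div_le hj hδ hV hy

end Derivative

/-! ### Uniform estimate for the scaled derivative of one row -/

theorem contDiffOn_scaledPartial :
    ContDiffOn ℝ 2 scaledPartial {m | 0 < m 2 - m 0 ^ 2 ∧ 0 < m 3 - m 1 ^ 2} := by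
  intro m hm
  have hV : m 2 - m 0 ^ 2 ≠ 0 := hm.1.ne'
  have hVW : (m 2 - m 0 ^ 2) * (m 3 - m 1 ^ 2) ≠ 0 := (mul_pos hm.1 hm.2).ne'
  have hs : Real.sqrt ((m 2 - m 0 ^ 2) * (m 3 - m 1 ^ 2)) ≠ 0 :=
    Real.sqrt_ne_zero'.2 (mul_pos hm.1 hm.2)
  have hp : ∀ i : Fin 7, ContDiffAt ℝ 2 (fun m : Fin 7 → ℝ => m i) m := fun i =>
    (contDiff_apply ℝ ℝ i).contDiffAt
  have hcV := (hp 2).sub ((hp 0).pow 2)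
  have hcs := (hcV.mul ((hp 3).sub ((hp 1).pow 2))).sqrt hVW
  exact ((((hp 6).sub (hp 1)).div hcs hs).sub
    ((((hp 4).sub ((hp 0).mul (hp 1))).mul ((hp 5).sub (hp 0))).div (hcV.mul hcs)
      (mul_ne_zero hV hs))).contDiffWithinAt

theorem isOpen_pos_variances :
    IsOpen {m : Fin 7 → ℝ | 0 < m 2 - m 0 ^ 2 ∧ 0 < m 3 - m 1 ^ 2} :=
  (isOpen_lt (f := fun _ : Fin 7 → ℝ => (0 : ℝ)) (g := fun m => m 2 - m 0 ^ 2)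
    (by fun_prop) (by fun_prop)).inter
    (isOpen_lt (f := fun _ : Fin 7 → ℝ => (0 : ℝ)) (g := fun m => m 3 - m 1 ^ 2)
      (by fun_prop) (by fun_prop))

theorem isCompact_moment_set (M v : ℝ) :
    IsCompact {m : Fin 7 → ℝ | ‖m‖ ≤ M ∧ v ≤ m 2 - m 0 ^ 2 ∧ v ≤ m 3 - m 1 ^ 2} := by
  refine Metric.isCompact_of_isClosed_isBounded ?_ ?_
  · exact (isClosed_le (f := fun m : Fin 7 → ℝ => ‖m‖) (g := fun _ => M)
        (by fun_prop) (by fun_prop)).inter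
      ((isClosed_le (f := fun _ : Fin 7 → ℝ => v) (g := fun m => m 2 - m 0 ^ 2)
        (by fun_prop) (by fun_prop)).inter
      (isClosed_le (f := fun _ : Fin 7 → ℝ => v) (g := fun m => m 3 - m 1 ^ 2)
        (by fun_prop) (by fun_prop)))
  · refine (Metric.isBounded_closedBall (x := (0 : Fin 7 → ℝ)) (r := M)).subset fun m hm => ?_
    rw [mem_closedBall_zero_iff]
    exact hm.1

theorem abs_features_le {ι : Type*} {x y : ι → ℝ} {B : ℝ} (hx : ∀ k, |x k| ≤ B)
    (hy : ∀ k, |y k| ≤ B) (j : ι) (i : Fin 7) (k : ι) : |features x y j i k| ≤ B + B ^ 2 := by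
  have hB : 0 ≤ B := (abs_nonneg _).trans (hx j)
  have h1 : B ≤ B + B ^ 2 := by linarith [sq_nonneg B]
  have h2 : ∀ s t : ℝ, |s| ≤ B → |t| ≤ B → |s * t| ≤ B + B ^ 2 := fun s t hs ht => by
    rw [abs_mul]
    have := mul_le_mul hs ht (abs_nonneg _) hB
    linarith
  fin_cases i
  · exact (hx k).trans h1
  · exact (hy k).trans h1
  · simpa [features, sq] using h2 _ _ (hx k) (hx k)
  · simpa [features, sq] using h2 _ _ (hy k) (hy k)
  · exact h2 _ _ (hx k) (hy k)
  · exact (hx j).trans h1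
  · exact (hy j).trans h1

theorem variance_eq {N : ℕ} (x : Fin N → ℝ) (j : Fin N) :
    variance x = mean Finset.univ (fun k => x k ^ 2) - mean Finset.univ x ^ 2 := by
  have hc : ((Finset.univ : Finset (Fin N)).card : ℝ) ≠ 0 := by
    exact_mod_cast (Finset.card_pos.2 ⟨j, Finset.mem_univ j⟩).ne'
  unfold variance
  rw [mean, sum_sub_mean_sq, mul_div_cancel_left₀ _ hc]

theorem exists_sum_scaled_deriv_corr_le (B σ δ : ℝ) (hσ : 0 < σ) (hδ : 0 < δ) :
    ∃ C : ℝ, ∀ (N : ℕ) (x y : Fin N → ℝ), (∀ k, |x k| ≤ B) → (∀ k, |y k| ≤ B) →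
      σ ^ 2 ≤ variance x → σ ^ 2 ≤ variance y → (∀ a b, x a ≠ x b → δ ≤ |x a - x b|) →
      ∀ (n : ℕ) (j : Fin N), 1 ≤ n → n ≤ N →
        |∑ S ∈ setsThrough j n,
          (n * deriv (fun t => corr S (Function.update x j t) y) (x j)
            - N * deriv (fun t => corr Finset.univ (Function.update x j t) y) (x j))|
          ≤ C / n * (setsThrough j n).card := by
  have hσ2 : 0 < σ ^ 2 := by positivity
  obtain ⟨ε, hε, C, hC0, hC⟩ := exists_uniform_taylor_bound isOpen_pos_variances
    (isCompact_moment_set (B + B ^ 2) (σ ^ 2))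
    (fun m hm => ⟨hσ2.trans_le hm.2.1, hσ2.trans_le hm.2.2⟩) contDiffOn_scaledPartial
  -- The first summand serves samples within ε of the full moments; the others serve, for distant
  -- samples, the scaled derivative, the value at `m₀` and the linear term.
  set A : ℝ := C + 4 / δ / ε ^ 4 + C / ε ^ 2 + C / ε with hA
  have hA0 : 0 ≤ A := by positivity
  refine ⟨A * (2 * (B + B ^ 2) + (7 : ℕ) * (4 * (B + B ^ 2) ^ 2 + 64 * (B + B ^ 2) ^ 4)), ?_⟩
  intro N x y hx hy hvx hvy hsep n j hn hnN
  have hB : 0 ≤ B := (abs_nonneg _).trans (hx j)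
  have hM0 : 0 ≤ B + B ^ 2 := by positivity
  have hn' : (0 : ℝ) < n := by exact_mod_cast hn
  have hN' : (0 : ℝ) < N := by exact_mod_cast (hn.trans hnN)
  have hF := abs_features_le hx hy j
  rw [variance_eq x j] at hvx
  rw [variance_eq y j] at hvy
  set m₀ : Fin 7 → ℝ := fun i => mean Finset.univ (features x y j i) with hm₀
  obtain ⟨hG0, hL, hT⟩ := hC m₀ ⟨(pi_norm_le_iff_of_nonneg hM0).2 fun i =>
    abs_mean_le _ hM0 (hF i), hvx, hvy⟩
  have huniv : (N : ℝ) * deriv (fun t => corr Finset.univ (Function.update x j t) y) (x j)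
      = scaledPartial m₀ := by
    rw [(hasDerivAt_corr_update (Finset.mem_univ j) (hσ2.trans_le hvx) (hσ2.trans_le hvy)).deriv,
      Finset.card_univ, Fintype.card_fin, mul_div_cancel₀ _ hN'.ne']
  simp only [huniv]
  refine abs_sum_setsThrough_delta_le hM0 hF j hn (by rwa [Fintype.card_fin]) _ _
    (fderiv ℝ scaledPartial m₀) hA0
    (hL.trans (by
      rw [hA]
      have : 0 ≤ 4 / δ / ε ^ 4 + C / ε ^ 2 + C / ε := by positivity
      linarith)) ?_
  intro S hS
  obtain ⟨hcard, hj⟩ := mem_setsThrough.1 hS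
  set m : Fin 7 → ℝ := fun i => mean S (features x y j i) with hm
  have hd : (fun i => mean S (features x y j i) - mean Finset.univ (features x y j i))
      = m - m₀ := rfl
  rw [hd]
  set r := ‖m - m₀‖ with hr
  have hr0 : 0 ≤ r := norm_nonneg _
  rcases le_or_gt r ε with hrε | hrε
  · obtain ⟨hmΩ, hTm⟩ := hT m hrε
    have hderiv := (hasDerivAt_corr_update hj hmΩ.1 hmΩ.2).deriv
    rw [hderiv, hcard, mul_div_cancel₀ _ hn'.ne']
    refine hTm.trans ?_
    have h1 : C ≤ A := by
      have : 0 ≤ 4 / δ / ε ^ 4 + C / ε ^ 2 + C / ε := by positivity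
      linarith
    exact mul_le_mul h1 (le_add_of_nonneg_right (by positivity)) (by positivity) hA0
  -- No expansion is available here. As r > ε, each of the three terms is bounded separately,
  -- inserting powers of r/ε: four against the O(n) derivative, enough to reach r² for the other
  -- two.
  · have hb := abs_deriv_corr_update_le (y := y) hj hδ hsep
    set D := deriv (fun t => corr S (Function.update x j t) y) (x j)
    have q2 : ε ^ 2 ≤ r ^ 2 := pow_le_pow_left₀ hε.le hrε.le 2
    have q4 : ε ^ 4 ≤ r ^ 4 := pow_le_pow_left₀ hε.le hrε.le 4
    have e1 : |(n : ℝ) * D| ≤ 4 / δ / ε ^ 4 * (n * r ^ 4) := by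
      rw [abs_mul, abs_of_pos hn']
      calc (n : ℝ) * |D| ≤ n * (4 / δ) := mul_le_mul_of_nonneg_left hb hn'.le
        _ = 4 / δ / ε ^ 4 * (n * ε ^ 4) := by field_simp
        _ ≤ _ := by gcongr
    have e2 : |scaledPartial m₀| ≤ C / ε ^ 2 * r ^ 2 := by
      calc _ ≤ C := hG0
        _ = C / ε ^ 2 * ε ^ 2 := by field_simp
        _ ≤ _ := by gcongr
    have e3 : |fderiv ℝ scaledPartial m₀ (m - m₀)| ≤ C / ε * r ^ 2 := by
      calc _ ≤ C * r := (ContinuousLinearMap.le_opNorm _ _).trans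
            (mul_le_mul_of_nonneg_right hL hr0)
        _ = C / ε * (ε * r) := by field_simp
        _ ≤ C / ε * (r * r) := by gcongr
        _ = _ := by ring
    have e4 := abs_sub ((n : ℝ) * D - scaledPartial m₀) (fderiv ℝ scaledPartial m₀ (m - m₀))
    have e5 := abs_sub ((n : ℝ) * D) (scaledPartial m₀)
    have e6 : A * (r ^ 2 + n * r ^ 4) = 4 / δ / ε ^ 4 * (n * r ^ 4) + C / ε ^ 2 * r ^ 2
        + C / ε * r ^ 2 + (C * (r ^ 2 + n * r ^ 4) + 4 / δ / ε ^ 4 * r ^ 2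
        + C / ε ^ 2 * (n * r ^ 4) + C / ε * (n * r ^ 4)) := by
      rw [hA]
      ring
    have e7 : 0 ≤ C * (r ^ 2 + n * r ^ 4) + 4 / δ / ε ^ 4 * r ^ 2
        + C / ε ^ 2 * (n * r ^ 4) + C / ε * (n * r ^ 4) := by positivity
    linarith

/-! ### Differentiability of the losses and averaging over users -/

section Loss

variable {NU NI : ℕ}

theorem differentiableAt_corr {S : Finset (Fin NI)} (i : Fin NU) (y : Fin NI → ℝ)
    {P : Fin NU → Fin NI → ℝ} (hP : 0 < ∑ j ∈ S, (P i j - mean S (P i)) ^ 2) :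
    DifferentiableAt ℝ (fun Q : Fin NU → Fin NI → ℝ => corr S (Q i) y) P := by
  have hy : 0 ≤ ∑ j ∈ S, (y j - mean S y) ^ 2 := Finset.sum_nonneg fun j _ => sq_nonneg _
  unfold corr
  -- If `y` is constant on `S`, the convention 0 for the quotient makes the correlation identically
  -- 0 in `Q`.
  rcases hy.eq_or_lt with hy | hy
  · simp only [← hy, mul_zero, Real.sqrt_zero, div_zero]
    exact differentiableAt_const _
  · have hpos := mul_pos hP hy
    have h1 : DifferentiableAt ℝ (fun Q : Fin NU → Fin NI → ℝ =>
        ∑ j ∈ S, (Q i j - mean S (Q i)) * (y j - mean S y)) P := by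
      unfold mean
      fun_prop
    have h2 : DifferentiableAt ℝ (fun Q : Fin NU → Fin NI → ℝ =>
        (∑ j ∈ S, (Q i j - mean S (Q i)) ^ 2) * ∑ j ∈ S, (y j - mean S y) ^ 2) P := by
      unfold mean
      fun_prop
    simp only [div_eq_mul_inv]
    exact h1.mul ((h2.sqrt hpos.ne').inv (Real.sqrt_ne_zero'.2 hpos))

theorem sum_sub_mean_sq_pos {ι : Type*} {S : Finset ι} {x : ι → ℝ} {a b : ι} (ha : a ∈ S)
    (hb : b ∈ S) (hab : x a ≠ x b) : 0 < ∑ j ∈ S, (x j - mean S x) ^ 2 := by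
  refine (Finset.sum_nonneg fun j _ => sq_nonneg _).lt_of_ne fun h => hab ?_
  have h0 := (Finset.sum_eq_zero_iff_of_nonneg fun j _ => sq_nonneg _).1 h.symm
  have h1 := pow_eq_zero_iff (two_ne_zero) |>.1 (h0 a ha)
  have h2 := pow_eq_zero_iff (two_ne_zero) |>.1 (h0 b hb)
  linarith

theorem differentiableAt_sampleLoss {SU : Finset (Fin NU)} {SI : Finset (Fin NI)}
    (Y : Fin NU → Fin NI → ℝ) {P : Fin NU → Fin NI → ℝ}
    (hP : ∀ i ∈ SU, 0 < ∑ j ∈ SI, (P i j - mean SI (P i)) ^ 2) :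
    DifferentiableAt ℝ (fun Q => sampleLoss SU SI Q Y) P := by
  simp only [sampleLoss, div_eq_mul_inv]
  exact (DifferentiableAt.fun_sum fun i hi =>
    (differentiableAt_corr i (Y i) (hP i hi)).const_sub 1).mul_const _

theorem fullLoss_eq_sampleLoss (P Y : Fin NU → Fin NI → ℝ) :
    fullLoss P Y = sampleLoss Finset.univ Finset.univ P Y := by
  unfold fullLoss sampleLoss
  rw [Finset.card_univ, Fintype.card_fin]

theorem grad_sampleLoss (SU : Finset (Fin NU)) (SI : Finset (Fin NI))
    (P Y : Fin NU → Fin NI → ℝ) (j : Fin NI) (i : Fin NU) :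
    grad j (fun Q => sampleLoss SU SI Q Y) P i =
      if i ∈ SU then
        -deriv (fun t => corr SI (Function.update (P i) j t) (Y i)) (P i j) / SU.card
      else 0 := by
  unfold grad sampleLoss
  split_ifs with hi
  · have h : ∀ t, (∑ k ∈ SU,
        (1 - corr SI (Function.update P i (Function.update (P i) j t) k) (Y k)))
        = (1 + ∑ k ∈ SU.erase i, (1 - corr SI (P k) (Y k)))
          - corr SI (Function.update (P i) j t) (Y i) := by
      intro t
      rw [← Finset.add_sum_erase SU _ hi, Function.update_self,
        Finset.sum_congr rfl fun k hk => by
          rw [Function.update_of_ne (Finset.ne_of_mem_erase hk)]]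
      ring
    simp only [h, deriv_div_const, deriv_const_sub]
  · have h : ∀ t, (∑ k ∈ SU,
        (1 - corr SI (Function.update P i (Function.update (P i) j t) k) (Y k)))
        = ∑ k ∈ SU, (1 - corr SI (P k) (Y k)) := fun t =>
      Finset.sum_congr rfl fun k hk => by
        rw [Function.update_of_ne (ne_of_mem_of_not_mem hk hi)]
    simp only [h, deriv_const]

theorem expect_of_eq_zero {N : ℕ} (j : Fin N) (n : ℕ) {f : Finset (Fin N) → ℝ}
    (hf : ∀ S, j ∉ S → f S = 0) :
    expect n f = (∑ S ∈ setsThrough j n, f S) / (N.choose n : ℝ) := by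
  unfold expect setsThrough
  rw [Finset.sum_filter_of_ne fun S _ hS => not_not.1 fun h => hS (hf S h)]

theorem expect_mul_const {N : ℕ} (n : ℕ) (f : Finset (Fin N) → ℝ) (c : ℝ) :
    expect n (fun S => f S * c) = expect n f * c := by
  unfold expect
  rw [← Finset.sum_mul, div_mul_eq_mul_div]

theorem expect_expect_grad_sampleLoss (P Y : Fin NU → Fin NI → ℝ) {m : ℕ} (n : ℕ) (hm : 1 ≤ m)
    (hmN : m ≤ NU) (j : Fin NI) (i : Fin NU) :
    expect m (fun SU => expect n (fun SI => grad j (fun Q => sampleLoss SU SI Q Y) P i))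
      = -expect n (fun SI =>
          deriv (fun t => corr SI (Function.update (P i) j t) (Y i)) (P i j)) / NU := by
  have hm' : (0 : ℝ) < m := by exact_mod_cast hm
  have hN' : (0 : ℝ) < NU := by exact_mod_cast (hm.trans hmN)
  have hch : (0 : ℝ) < NU.choose m := by exact_mod_cast Nat.choose_pos hmN
  rw [expect_of_eq_zero i m fun SU hi => by
    simp only [grad_sampleLoss, if_neg hi]
    simp [expect]]
  set E := expect n (fun SI =>
          deriv (fun t => corr SI (Function.update (P i) j t) (Y i)) (P i j)) with hE
  have h : ∀ SU ∈ setsThrough i m,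
      expect n (fun SI => grad j (fun Q => sampleLoss SU SI Q Y) P i) = E * (-1 / m) := by
    intro SU hSU
    obtain ⟨hc, hi⟩ := mem_setsThrough.1 hSU
    simp only [grad_sampleLoss, if_pos hi, hc]
    rw [hE, ← expect_mul_const]
    congr 1
    funext SI
    ring
  rw [Finset.sum_congr rfl h, Finset.sum_const, nsmul_eq_mul]
  have hcard := card_mul_card_setsThrough i hm
  rw [Fintype.card_fin] at hcard
  rw [div_eq_div_iff hch.ne' hN'.ne']
  field_simp
  linear_combination (-E) * hcard

end Loss

end SampleCorr

/-! ### Assembly of the main theorem -/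

theorem mainTheorem1 (B σ δ : ℝ) (hσ : 0 < σ) (hδ : 0 < δ) :
    ∃ C : ℝ, ∀ (NU NI : ℕ) (P Y : Fin NU → Fin NI → ℝ),
      (∀ i j, |P i j| ≤ B) →
      (∀ i j, |Y i j| ≤ B) →
      (∀ i, σ ^ 2 ≤ SampleCorr.variance (P i)) →
      (∀ i, σ ^ 2 ≤ SampleCorr.variance (Y i)) →
      (∀ i a b, P i a ≠ P i b → δ ≤ |P i a - P i b|) →
      DifferentiableAt ℝ (fun Q => SampleCorr.fullLoss Q Y) P ∧
      (∀ (SU : Finset (Fin NU)) (SI : Finset (Fin NI)),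
        (∀ i ∈ SU, ∃ a ∈ SI, ∃ b ∈ SI, P i a ≠ P i b) →
        DifferentiableAt ℝ (fun Q => SampleCorr.sampleLoss SU SI Q Y) P) ∧
      ∀ (m n : ℕ), 1 ≤ m → m ≤ NU → 1 ≤ n → n ≤ NI →
        ∀ (j : Fin NI) (i : Fin NU),
          |SampleCorr.expect m (fun SU => SampleCorr.expect n (fun SI =>
              SampleCorr.grad j (fun Q => SampleCorr.sampleLoss SU SI Q Y) P i))
            - SampleCorr.grad j (fun Q => SampleCorr.fullLoss Q Y) P i|
          ≤ C / ((NU : ℝ) * (NI : ℝ) * (n : ℝ)) := by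
  obtain ⟨C, hC⟩ := SampleCorr.exists_sum_scaled_deriv_corr_le B σ δ hσ hδ
  refine ⟨C, fun NU NI P Y hP hY hvP hvY hsep => ⟨?_, ?_, ?_⟩⟩
  · simp only [SampleCorr.fullLoss_eq_sampleLoss]
    refine SampleCorr.differentiableAt_sampleLoss Y fun i _ => ?_
    refine (Finset.sum_nonneg fun j _ => sq_nonneg _).lt_of_ne fun h => ?_
    have := hvP i
    rw [SampleCorr.variance, SampleCorr.mean, ← h, zero_div] at this
    linarith [pow_pos hσ 2]
  · intro SU SI h
    refine SampleCorr.differentiableAt_sampleLoss Y fun i hi => ?_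
    obtain ⟨a, ha, b, hb, hab⟩ := h i hi
    exact SampleCorr.sum_sub_mean_sq_pos ha hb hab
  · intro m n hm hmN hn hnN j i
    have hNU : (0 : ℝ) < NU := by exact_mod_cast (hm.trans hmN)
    have hNI : (0 : ℝ) < NI := by exact_mod_cast (hn.trans hnN)
    have hn' : (0 : ℝ) < n := by exact_mod_cast hn
    have hch : (0 : ℝ) < NI.choose n := by exact_mod_cast Nat.choose_pos hnN
    have key := hC NI (P i) (Y i) (hP i) (hY i) (hvP i) (hvY i) (hsep i) n j hn hnN
    have hcard := SampleCorr.card_mul_card_setsThrough j hn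
    rw [Fintype.card_fin] at hcard
    simp only [SampleCorr.fullLoss_eq_sampleLoss]
    rw [SampleCorr.expect_expect_grad_sampleLoss P Y n hm hmN, SampleCorr.grad_sampleLoss,
      if_pos (Finset.mem_univ i), Finset.card_univ, Fintype.card_fin,
      SampleCorr.expect_of_eq_zero j n fun S hS => by
        simp only [SampleCorr.corr_update_of_notMem hS, deriv_const]]
    rw [Finset.sum_sub_distrib, ← Finset.mul_sum, Finset.sum_const, nsmul_eq_mul] at key
    set c : ℝ := ((SampleCorr.setsThrough j n).card : ℝ)
    set E := ∑ S ∈ SampleCorr.setsThrough j n,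
      deriv (fun t => SampleCorr.corr S (Function.update (P i) j t) (Y i)) (P i j)
    set D := deriv (fun t => SampleCorr.corr Finset.univ (Function.update (P i) j t) (Y i)) (P i j)
    have hc : 0 < c := pos_of_mul_pos_right (hcard ▸ mul_pos hn' hch) hNI.le
    -- The share n/N_I of samples through `j` cancels the scaling by n and N_I in `key`, leaving its
    -- bound C/n multiplied by 1/(N_U N_I).
    have hch' : (NI.choose n : ℝ) = NI * c / n := by
      rw [hcard]
      rw [mul_div_cancel_left₀ _ hn'.ne']
    clear hC hP hY hvP hvY hsep
    clear_value c E D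
    have e : -(E / (NI.choose n : ℝ)) / NU - -D / NU
        = -((n * E - c * (NI * D)) / (NU * NI * c)) := by
      rw [hch']
      field_simp
      ring
    rw [e, abs_neg, abs_div, abs_of_pos (mul_pos (mul_pos hNU hNI) hc),
      div_le_iff₀ (mul_pos (mul_pos hNU hNI) hc)]
    refine key.trans (le_of_eq ?_)
    field_simp
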